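/- Let $n\ge 1$, let $p,q\in(1,\infty)$ with $1/p+1/q=1$, and let $\Omega\subseteq\mathbb R^n$ be a bounded connected open Lipschitz set. Let $\Gamma_D,\Gamma_N\subseteq\partial\Omega$ be disjoint relatively open subsets of $\partial\Omega$ with $\overline{\Gamma}_D\cup\overline{\Gamma}_N=\partial\Omega$, $\mathcal H^{n-1}(\overline\Gamma_D\setminus\Gamma_D)=\mathcal H^{n-1}(\overline\Gamma_N\setminus\Gamma_N)=0$ and $\Gamma_D\neq\emptyset$. Let $W^{1/q,p}(\partial\Omega;\mathbb R^n)$ be the space of $g\in L^p(\partial\Omega;\mathbb R^n)$ with $\int_{\partial\Omega\times\partial\Omega}|g(x)-g(y)|^p\,|x-y|^{-(n+p-2)}\,d\mathcal H^{n-1}(x)\,d\mathcal H^{n-1}(y)<\infty$, and let $W^{-1/q,q}(\partial\Omega;\mathbb R^n)$ be its dual. Let $f\in L^q(\Omega;\mathbb R^n)$, $g_D\in W^{1/q,p}(\partial\Omega;\mathbb R^n)$ and $h_N\in W^{-1/q,q}(\partial\Omega;\mathbb R^n)$. Set $X:=L^p(\Omega;\mathbb R^{n\times n})\times L^q(\Omega;\mathbb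 R^{n\times n})$. Let $\mathcal E\subseteq X$ be the set of all $(F,P)\in X$ such that $F=Du$ for some $u\in W^{1,p}(\Omega;\mathbb R^n)$ with $u=g_D$ $\mathcal H^{n-1}$-a.e. on $\Gamma_D$ in the sense of traces; $\operatorname{div}P+f=0$ in $\Omega$ in the sense of distributions; $P\nu=h_N$ on $\Gamma_N$, in the sense that the normal trace $B_\nu P\in W^{-1/q,q}(\partial\Omega;\mathbb R^n)$, given by $\langle B_\nu P,Bu\rangle=\int_\Omega P\cdot Du\,dx+\int_\Omega u\cdot\operatorname{div}P\,dx$ for all $u\in W^{1,p}(\Omega;\mathbb R^n)$ with trace $Bu$, satisfies $\langle B_\nu P,\varphi\rangle=\langle h_N,\varphi\rangle$ for all $\varphi\in W^{1/q,p}(\partial\Omega;\mathbb R^n)$ that vanish $\mathcal H^{n-1}$-a.e. on $\partial\Omega\setminus\Gamma_N$; and $FP^T$ is symmetric a.e. in $\Omega$. Let $V:\mathbb R^{n\times n}\to[0,\infty)$ be convex with $V(0)=0$, let $V^*(\eta)=\sup_\xi(\xi\cdot\eta-V(\xi))$, and assume that there are $c_p,c_q>0$ with $V(\xi)\ge c_p|\xi|^p$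 and $V^*(\eta)\ge c_q|\eta|^q$ for all $\xi,\eta$. Let $\mathcal D_{\rm loc}\subseteq\mathbb R^{n\times n}\times\mathbb R^{n\times n}$ be non-empty, let $\mathcal D:=\{(F,P)\in X:(F(x),P(x))\in\mathcal D_{\rm loc}\text{ for a.e. }x\in\Omega\}$, and set $\psi(F,P):=\inf\{V(F-F')+V^*(P-P'):(F',P')\in\mathcal D_{\rm loc}\}$ for $F,P\in\mathbb R^{n\times n}$. Define $J(F,P):=\int_\Omega\psi(F(x),P(x))\,dx$ if $(F,P)\in\mathcal E$ and $J(F,P):=\infty$ for all other $(F,P)\in X$. Define $I((F,P),(F',P')):=\int_\Omega\big(V(F-F')+V^*(P-P')\big)\,dx$ if $(F,P)\in\mathcal E$ and $(F',P')\in\mathcal D$, and $I:=\infty$ otherwise on $X\times X$. Call $(F,P)\in X$ a strong solution if $(F,P)\in\mathcal E\cap\mathcal D$. Call $((F,P),(F',P'))\in\mathcal E\times\mathcal D$ a generalized solution if it minimizes $I$ in $\mathcal E\times\mathcal D$. For $T:\mathbb R^{n\times n}\to\mathbb R^{n\times n}$, call $u\in W^{1,p}(\Omega;\mathbb R^n)$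 a classical solution if $(Du,T(Du))\in\mathcal E$ (in particular $T(Du)\in L^q(\Omega;\mathbb R^{n\times n})$). Theorem. Let $(F,P)\in X$. Then $(F,P)$ is a strong solution if and only if $((F,P),(F,P))$ is a generalized solution. If $\mathcal D_{\rm loc}$ is closed (equivalently, if the infimum that defines $\psi$ is always attained), then $(F,P)$ is a strong solution if and only if $J(F,P)=0$; thus the three properties are equivalent. If $\mathcal D$ is generated by a function $T:\mathbb R^{n\times n}\to\mathbb R^{n\times n}$, that is, $\mathcal D=\{(F,P)\in X:P=T(F)\text{ a.e. in }\Omega\}$, then $(F,P)$ is a strong solution if and only if there is a classical solution $u\in W^{1,p}(\Omega;\mathbb R^n)$ with $F=Du$ and $P=T(Du)$. -/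

import Mathlib

open MeasureTheory Filter Topology Set
open scoped ENNReal NNReal ContDiff Distributions

attribute [local instance] Matrix.frobeniusNormedAddCommGroup Matrix.frobeniusNormedSpace

namespace DataDriven

noncomputable section

/-- The space `ℝⁿ` with its Euclidean norm. -/
abbrev Vec (n : ℕ) : Type := EuclideanSpace ℝ (Fin n)

/-- The space `ℝⁿˣⁿ`; its norm is the Euclidean (Frobenius) one. -/
abbrev Mat (n : ℕ) : Type := Matrix (Fin n) (Fin n) ℝ

/-- The Euclidean scalar product `A · B = ∑ᵢⱼ Aᵢⱼ Bᵢⱼ` of matrices. -/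
def frob {n : ℕ} (A B : Mat n) : ℝ := ∑ i, ∑ j, A i j * B i j

/-- The `j`-th standard basis vector. -/
def basisVec {n : ℕ} (j : Fin n) : Vec n := EuclideanSpace.single j (1 : ℝ)

/-- The Jacobian matrix `(∂ⱼ vᵢ)ᵢⱼ` of a classically differentiable map. -/
def jacobian {n : ℕ} (v : Vec n → Vec n) (x : Vec n) : Mat n :=
  Matrix.of fun i j => fderiv ℝ v x (basisVec j) i

/-! ### The domain and its boundary -/

/-- Lipschitz domain: near each boundary point, `Ω` is the strict epigraph, in some unit direction
`e`, of a Lipschitz function of the component orthogonal to `e`. -/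
def IsLipschitzDomain {n : ℕ} (Ω : Set (Vec n)) : Prop :=
  ∀ x ∈ frontier Ω, ∃ r : ℝ, 0 < r ∧ ∃ e : Vec n, ‖e‖ = 1 ∧
    ∃ (γ : Vec n → ℝ) (K : ℝ≥0), LipschitzWith K γ ∧
      ∀ y ∈ Metric.ball x r, y ∈ Ω ↔ γ (y - inner ℝ e y • e) < inner ℝ e y

/-- The surface measure `ℋⁿ⁻¹` restricted to `∂Ω`. -/
def surfaceMeasure {n : ℕ} (Ω : Set (Vec n)) : Measure (Vec n) :=
  (μHE[n - 1] : Measure (Vec n)).restrict (frontier Ω)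

/-- `A` is a relatively open subset of `S`. -/
def IsRelOpenIn {n : ℕ} (A S : Set (Vec n)) : Prop :=
  ∃ U : Set (Vec n), IsOpen U ∧ A = U ∩ S

/-- The standing assumptions on the reference configuration `Ω` and on the Dirichlet and Neumann
parts of its boundary. -/
structure IsReferenceBody {n : ℕ} (Ω ΓD ΓN : Set (Vec n)) : Prop where
  isOpen : IsOpen Ω
  bounded : Bornology.IsBounded Ω
  connected : IsConnected Ω
  lipschitz : IsLipschitzDomain Ω
  relOpen_dirichlet : IsRelOpenIn ΓD (frontier Ω)
  relOpen_neumann : IsRelOpenIn ΓN (frontier Ω)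
  disjoint : Disjoint ΓD ΓN
  cover : closure ΓD ∪ closure ΓN = frontier Ω
  null_dirichlet : (μHE[n - 1] : Measure (Vec n)) (closure ΓD \ ΓD) = 0
  null_neumann : (μHE[n - 1] : Measure (Vec n)) (closure ΓN \ ΓN) = 0
  dirichlet_nonempty : ΓD.Nonempty

/-! ### Lebesgue, Sobolev and trace spaces -/

section Spaces

variable {n : ℕ}

/-- `Lᵖ(Ω; ℝⁿ)`. -/
abbrev LpVec (Ω : TopologicalSpace.Opens (Vec n)) (p : ℝ) : Type :=
  Lp (Vec n) (ENNReal.ofReal p) (volume.restrict (Ω : Set (Vec n)))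

/-- `Lᵖ(Ω; ℝⁿˣⁿ)`. -/
abbrev LpMat (Ω : TopologicalSpace.Opens (Vec n)) (p : ℝ) : Type :=
  Lp (Mat n) (ENNReal.ofReal p) (volume.restrict (Ω : Set (Vec n)))

/-- The phase space `X_{p,q}(Ω) = Lᵖ(Ω; ℝⁿˣⁿ) × L^q(Ω; ℝⁿˣⁿ)`. -/
abbrev PhaseSpace (Ω : TopologicalSpace.Opens (Vec n)) (p q : ℝ) : Type :=
  LpMat Ω p × LpMat Ω q

/-- `G` is the gradient of `u` in the sense of distributions on `Ω`: `Gᵢⱼ = ∂ⱼ uᵢ`. -/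
def IsWeakGrad (Ω : TopologicalSpace.Opens (Vec n)) (u : Vec n → Vec n) (G : Vec n → Mat n) :
    Prop :=
  ∀ φ : 𝓓(Ω, ℝ), ∀ i j : Fin n,
    ∫ x in (Ω : Set (Vec n)), u x i * fderiv ℝ φ x (basisVec j) =
      -∫ x in (Ω : Set (Vec n)), G x i j * φ x

/-- `d` is the rowwise divergence of `P` in the sense of distributions on `Ω`:
`dᵢ = ∑ⱼ ∂ⱼ Pᵢⱼ`. -/
def IsWeakDiv (Ω : TopologicalSpace.Opens (Vec n)) (P : Vec n → Mat n) (d : Vec n → Vec n) :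
    Prop :=
  ∀ φ : 𝓓(Ω, ℝ), ∀ i : Fin n,
    ∫ x in (Ω : Set (Vec n)), ∑ j, P x i j * fderiv ℝ φ x (basisVec j) =
      -∫ x in (Ω : Set (Vec n)), d x i * φ x

/-- The Sobolev space `W^{1,p}(Ω; ℝⁿ)`. -/
def Sobolev (Ω : TopologicalSpace.Opens (Vec n)) (p : ℝ) : Type :=
  {u : LpVec Ω p // ∃ G : LpMat Ω p, IsWeakGrad Ω u G}

/-- The weak gradient `Du ∈ Lᵖ(Ω; ℝⁿˣⁿ)` of `u ∈ W^{1,p}(Ω; ℝⁿ)`. -/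
def Sobolev.grad {Ω : TopologicalSpace.Opens (Vec n)} {p : ℝ} (u : Sobolev Ω p) : LpMat Ω p :=
  u.2.choose

/-- The integrand of the Gagliardo seminorm on `∂Ω`, taken to the power `1/p`:
`(f(x) - f(y)) / |x - y|^((n + p - 2) / p)`. -/
def gagliardoQuotient (p : ℝ) (f : Vec n → Vec n) (z : Vec n × Vec n) : Vec n :=
  (‖z.1 - z.2‖ ^ ((n + p - 2) / p))⁻¹ • (f z.1 - f z.2)

/-- The trace space `W^{1-1/p,p}(∂Ω; ℝⁿ)`, as a space of functions (not identified when they agree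
almost everywhere on `∂Ω`). -/
def TraceSpace (Ω : Set (Vec n)) (p : ℝ) : Submodule ℝ (Vec n → Vec n) where
  carrier := {f | MemLp f (ENNReal.ofReal p) (surfaceMeasure Ω) ∧
    MemLp (gagliardoQuotient p f) (ENNReal.ofReal p)
      ((surfaceMeasure Ω).prod (surfaceMeasure Ω))}
  zero_mem' := by
    refine ⟨MemLp.zero, ?_⟩
    have h : gagliardoQuotient p (0 : Vec n → Vec n) = 0 := by
      funext z
      simp [gagliardoQuotient]
    rw [h]
    exact MemLp.zero
  add_mem' := by
    rintro f g ⟨hf, hf'⟩ ⟨hg, hg'⟩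
    refine ⟨hf.add hg, ?_⟩
    have h : gagliardoQuotient p (f + g) = gagliardoQuotient p f + gagliardoQuotient p g := by
      funext z
      simp only [gagliardoQuotient, Pi.add_apply, ← smul_add]
      congr 1
      abel
    rw [h]
    exact hf'.add hg'
  smul_mem' := by
    rintro c f ⟨hf, hf'⟩
    refine ⟨hf.const_smul c, ?_⟩
    have h : gagliardoQuotient p (c • f) = c • gagliardoQuotient p f := by
      funext z
      simp only [gagliardoQuotient, Pi.smul_apply, ← smul_sub]
      rw [smul_comm]
    rw [h]
    exact hf'.const_smul c

/-- The norm `‖f‖_{Lᵖ(∂Ω)} + [f]_{1-1/p,p}` of the trace space. -/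
def traceNorm {Ω : Set (Vec n)} {p : ℝ} (f : TraceSpace Ω p) : ℝ :=
  (eLpNorm (f : Vec n → Vec n) (ENNReal.ofReal p) (surfaceMeasure Ω)).toReal +
    (eLpNorm (gagliardoQuotient p (f : Vec n → Vec n)) (ENNReal.ofReal p)
      ((surfaceMeasure Ω).prod (surfaceMeasure Ω))).toReal

/-- The dual `W^{-1+1/p,q}(∂Ω; ℝⁿ)` of the trace space `W^{1-1/p,p}(∂Ω; ℝⁿ)`. -/
def TraceDual (Ω : Set (Vec n)) (p : ℝ) : Type :=
  {ℓ : TraceSpace Ω p →ₗ[ℝ] ℝ // ∃ C : ℝ, ∀ ψ, |ℓ ψ| ≤ C * traceNorm ψ}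

/-- `ψ ∈ Lᵖ(∂Ω; ℝⁿ)` is the trace of `u ∈ W^{1,p}(Ω; ℝⁿ)`: there are `C¹` maps that converge to `u`
in `W^{1,p}(Ω; ℝⁿ)` and whose restrictions to `∂Ω` converge to `ψ` in `Lᵖ(∂Ω; ℝⁿ)`. -/
def IsTrace {Ω : TopologicalSpace.Opens (Vec n)} {p : ℝ} (u : Sobolev Ω p)
    (ψ : Vec n → Vec n) : Prop :=
  MemLp ψ (ENNReal.ofReal p) (surfaceMeasure (Ω : Set (Vec n))) ∧
  ∃ v : ℕ → Vec n → Vec n, (∀ k, ContDiff ℝ 1 (v k)) ∧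
    Tendsto (fun k => eLpNorm (fun x => v k x - u.1 x) (ENNReal.ofReal p)
      (volume.restrict (Ω : Set (Vec n)))) atTop (𝓝 0) ∧
    Tendsto (fun k => eLpNorm (fun x => jacobian (v k) x - u.grad x) (ENNReal.ofReal p)
      (volume.restrict (Ω : Set (Vec n)))) atTop (𝓝 0) ∧
    Tendsto (fun k => eLpNorm (fun x => v k x - ψ x) (ENNReal.ofReal p)
      (surfaceMeasure (Ω : Set (Vec n)))) atTop (𝓝 0)

/-- `ℓ` is the normal trace `B_ν P ∈ W^{-1/q,q}(∂Ω; ℝⁿ)` (which stands for `P ν`) of a field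
`P ∈ L^q(Ω; ℝⁿˣⁿ)` with `div P ∈ L^q(Ω; ℝⁿ)`: for all `u ∈ W^{1,p}(Ω; ℝⁿ)` with trace `ψ`,
`⟨ℓ, ψ⟩ = ∫ P · Du + ∫ u · div P`. -/
def IsNormalTrace {Ω : TopologicalSpace.Opens (Vec n)} {p q : ℝ} (P : LpMat Ω q)
    (ℓ : TraceDual (Ω : Set (Vec n)) p) : Prop :=
  ∃ d : LpVec Ω q, IsWeakDiv Ω P d ∧
    ∀ (u : Sobolev Ω p) (ψ : TraceSpace (Ω : Set (Vec n)) p), IsTrace u ψ →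
      ℓ.1 ψ = ∫ x in (Ω : Set (Vec n)), frob (P x) (u.grad x) +
        ∫ x in (Ω : Set (Vec n)), inner ℝ (u.1 x) (d x)

/-! ### Admissible states -/

/-- Body force `f ∈ L^q(Ω; ℝⁿ)`, boundary displacement `g_D ∈ W^{1/q,p}(∂Ω; ℝⁿ)` and boundary
traction `h_N ∈ W^{-1/q,q}(∂Ω; ℝⁿ)` (recall `1/q = 1 - 1/p`). -/
structure Forcing (Ω : TopologicalSpace.Opens (Vec n)) (p q : ℝ) where
  f : LpVec Ω q
  gD : TraceSpace (Ω : Set (Vec n)) p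
  hN : TraceDual (Ω : Set (Vec n)) p

/-- The boundary condition `u = g_D` on `ΓD`, in the sense of traces. -/
def DirichletCondition {Ω : TopologicalSpace.Opens (Vec n)} {p : ℝ} (ΓD : Set (Vec n))
    (gD : TraceSpace (Ω : Set (Vec n)) p) (u : Sobolev Ω p) : Prop :=
  ∃ ψ : Vec n → Vec n, IsTrace u ψ ∧
    ∀ᵐ x ∂(surfaceMeasure (Ω : Set (Vec n))), x ∈ ΓD → ψ x = (gD : Vec n → Vec n) x

/-- The boundary condition `P ν = h_N` on `ΓN`: `⟨B_ν P, ψ⟩ = ⟨h_N, ψ⟩` for all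
`ψ ∈ W^{1/q,p}(∂Ω; ℝⁿ)` that vanish almost everywhere on `∂Ω ∖ ΓN`. -/
def NeumannCondition {Ω : TopologicalSpace.Opens (Vec n)} {p q : ℝ} (ΓN : Set (Vec n))
    (hN : TraceDual (Ω : Set (Vec n)) p) (P : LpMat Ω q) : Prop :=
  ∃ ℓ : TraceDual (Ω : Set (Vec n)) p, IsNormalTrace P ℓ ∧
    ∀ ψ : TraceSpace (Ω : Set (Vec n)) p,
      (∀ᵐ x ∂(surfaceMeasure (Ω : Set (Vec n))), x ∉ ΓN → (ψ : Vec n → Vec n) x = 0) →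
        ℓ.1 ψ = hN.1 ψ

/-- The states that are compatible and in force equilibrium. -/
def forceEquilibriumSet (Ω : TopologicalSpace.Opens (Vec n)) (p q : ℝ) (ΓD ΓN : Set (Vec n))
    (L : Forcing Ω p q) : Set (PhaseSpace Ω p q) :=
  {y | (∃ u : Sobolev Ω p, y.1 = u.grad ∧ DirichletCondition ΓD L.gD u) ∧
    IsWeakDiv Ω y.2 (fun x => -(L.f x)) ∧ NeumannCondition ΓN L.hN y.2}

/-- The constraint set `ℰ`: the states that are compatible and in force and moment equilibrium. -/
def constraintSet (Ω : TopologicalSpace.Opens (Vec n)) (p q : ℝ) (ΓD ΓN : Set (Vec n))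
    (L : Forcing Ω p q) : Set (PhaseSpace Ω p q) :=
  {y | y ∈ forceEquilibriumSet Ω p q ΓD ΓN L ∧
    ∀ᵐ x ∂(volume.restrict (Ω : Set (Vec n))), (y.1 x * (y.2 x).transpose).IsSymm}

/-! ### Material data sets -/

/-- The material data set `𝒟` of the local material with local data set `Dloc`. -/
def materialDataSet (Ω : TopologicalSpace.Opens (Vec n)) (p q : ℝ) (Dloc : Set (Mat n × Mat n)) :
    Set (PhaseSpace Ω p q) :=
  {y | ∀ᵐ x ∂(volume.restrict (Ω : Set (Vec n))), (y.1 x, y.2 x) ∈ Dloc}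

/-- The local data set `{(F, T F)}` generated by a stress-strain function `T`. -/
def graphDataSet (T : Mat n → Mat n) : Set (Mat n × Mat n) := {z | z.2 = T z.1}

/-! ### Deviation functions and functionals -/

/-- The convex conjugate `V*(η) = sup_ξ (ξ · η - V ξ)`. -/
def conjugate (V : Mat n → ℝ) (η : Mat n) : ℝ := ⨆ ξ : Mat n, (frob ξ η - V ξ)

/-- The standing assumptions on the deviation function `V`. -/
structure IsDeviationFunction (p q : ℝ) (V : Mat n → ℝ) : Prop where
  nonneg : ∀ ξ, 0 ≤ V ξ
  convex : ConvexOn ℝ univ V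
  map_zero : V 0 = 0
  growth : ∃ c : ℝ, 0 < c ∧ ∀ ξ, c * ‖ξ‖ ^ p ≤ V ξ
  growth_conjugate : ∃ c : ℝ, 0 < c ∧ ∀ η, c * ‖η‖ ^ q ≤ conjugate V η

/-- The local deviation `V(F - F') + V*(P - P')` between two local states. -/
def localDeviation (V : Mat n → ℝ) (z z' : Mat n × Mat n) : ℝ :=
  V (z.1 - z'.1) + conjugate V (z.2 - z'.2)

/-- `ψ(F, P)`, the infimum of `V(F - F') + V*(P - P')` over `(F', P') ∈ Dloc`. -/
def localDistance (V : Mat n → ℝ) (Dloc : Set (Mat n × Mat n)) (z : Mat n × Mat n) : ℝ :=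
  sInf (localDeviation V z '' Dloc)

open Classical in
/-- The functional `J(F, P) = ∫_Ω ψ(F, P) dx` on `E`, and `∞` elsewhere. -/
def functionalJ {Ω : TopologicalSpace.Opens (Vec n)} {p q : ℝ} (V : Mat n → ℝ)
    (Dloc : Set (Mat n × Mat n)) (E : Set (PhaseSpace Ω p q)) (y : PhaseSpace Ω p q) : ℝ≥0∞ :=
  if y ∈ E then
    ∫⁻ x in (Ω : Set (Vec n)), ENNReal.ofReal (localDistance V Dloc (y.1 x, y.2 x))
  else ∞

open Classical in
/-- The functional `I((F, P), (F', P')) = ∫_Ω V(F - F') + V*(P - P') dx` on `E × D`, and `∞`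
elsewhere. -/
def functionalI {Ω : TopologicalSpace.Opens (Vec n)} {p q : ℝ} (V : Mat n → ℝ)
    (E D : Set (PhaseSpace Ω p q)) (w : PhaseSpace Ω p q × PhaseSpace Ω p q) : ℝ≥0∞ :=
  if w.1 ∈ E ∧ w.2 ∈ D then
    ∫⁻ x in (Ω : Set (Vec n)),
      ENNReal.ofReal (localDeviation V (w.1.1 x, w.1.2 x) (w.2.1 x, w.2.2 x))
  else ∞

/-! ### Notions of solution -/

/-- A strong solution is an admissible state in the data set. -/
def IsStrongSolution {Ω : TopologicalSpace.Opens (Vec n)} {p q : ℝ}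
    (E D : Set (PhaseSpace Ω p q)) (y : PhaseSpace Ω p q) : Prop :=
  y ∈ E ∩ D

/-- A generalized solution is an element of `E × D` that minimizes `I` in `E × D`. -/
def IsGeneralizedSolution {Ω : TopologicalSpace.Opens (Vec n)} {p q : ℝ} (V : Mat n → ℝ)
    (E D : Set (PhaseSpace Ω p q)) (w : PhaseSpace Ω p q × PhaseSpace Ω p q) : Prop :=
  w ∈ E ×ˢ D ∧ IsMinOn (functionalI V E D) (E ×ˢ D) w

/-- `P = T(Du)` almost everywhere in `Ω`. -/
def IsStressOf {Ω : TopologicalSpace.Opens (Vec n)} {p q : ℝ} (T : Mat n → Mat n)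
    (u : Sobolev Ω p) (P : LpMat Ω q) : Prop :=
  ∀ᵐ x ∂(volume.restrict (Ω : Set (Vec n))), P x = T (u.grad x)

/-- `u ∈ W^{1,p}(Ω; ℝⁿ)` is a classical solution: `T(Du)` lies in `L^q(Ω; ℝⁿˣⁿ)` and
`(Du, T(Du)) ∈ E`. -/
def IsClassicalSolution {Ω : TopologicalSpace.Opens (Vec n)} {p q : ℝ} (T : Mat n → Mat n)
    (E : Set (PhaseSpace Ω p q)) (u : Sobolev Ω p) : Prop :=
  ∃ S : LpMat Ω q, IsStressOf T u S ∧ (u.grad, S) ∈ E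

end Spaces

end

end DataDriven

open DataDriven

namespace DataDriven

/-! The deviation `V(F - F') + V*(P - P')` is nonnegative and vanishes when the two states agree.
Hence `I` takes its least possible value 0 at `(y, y)` for `y ∈ E ∩ D`; conversely, membership in `E
× D` alone makes `y` strong. For `J`, the growth of `V` and `V*` makes the deviation control the
distance between states, so `ψ(z) ≤ 0` forces `z` into the closure of `Dloc`, that is, into `Dloc`
when it is closed. An integral of a nonnegative function vanishes iff the function does a.e., once
`ψ(F, P)` is measurable: `ψ` is upper semicontinuous, being an infimum of continuous functions. The
classical case unfolds the definitions. Nothing about traces or the regularity of `Ω` enters. -/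

theorem exists_le_mul_norm_of_finiteDimensional {W : Type*} [NormedAddCommGroup W]
    [NormedSpace ℝ W] [FiniteDimensional ℝ W] (f : W →ₗ[ℝ] ℝ) :
    ∃ C : ℝ, ∀ x, f x ≤ C * ‖x‖ :=
  ⟨‖f.toContinuousLinearMap‖, fun x =>
    (le_abs_self _).trans (f.toContinuousLinearMap.le_opNorm x)⟩

/-- The pair is strongly measurable, hence measurable into the Borel σ-algebra of the product
topology; no σ-algebra on the factors is involved. -/
theorem aemeasurable_comp_of_upperSemicontinuous {α W₁ W₂ : Type*} [MeasurableSpace α]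
    [NormedAddCommGroup W₁] [NormedAddCommGroup W₂] {μ : Measure α} {f : W₁ × W₂ → ℝ}
    {g : α → W₁} {h : α → W₂} (hf : UpperSemicontinuous f) (hg : AEStronglyMeasurable g μ)
    (hh : AEStronglyMeasurable h μ) : AEMeasurable (fun x => f (g x, h x)) μ := by
  let _ : MeasurableSpace (W₁ × W₂) := borel _
  have _ : BorelSpace (W₁ × W₂) := ⟨rfl⟩
  exact hf.measurable.comp_aemeasurable (hg.prodMk hh).aemeasurable

section Frobenius

variable {n : ℕ}

theorem frob_add_left (A B C : Mat n) : frob (A + B) C = frob A C + frob B C := by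
  simp [frob, add_mul, Finset.sum_add_distrib]

theorem frob_add_right (A B C : Mat n) : frob A (B + C) = frob A B + frob A C := by
  simp [frob, mul_add, Finset.sum_add_distrib]

theorem frob_smul_left (c : ℝ) (A B : Mat n) : frob (c • A) B = c * frob A B := by
  simp [frob, Finset.mul_sum, mul_assoc]

theorem frob_smul_right (c : ℝ) (A B : Mat n) : frob A (c • B) = c * frob A B := by
  simp [frob, Finset.mul_sum, mul_left_comm]

theorem frob_zero_right (A : Mat n) : frob A 0 = 0 := by
  simp [frob]

theorem exists_frob_le_mul_norm (η : Mat n) :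
    ∃ C : ℝ, ∀ ξ : Mat n, frob ξ η ≤ C * ‖ξ‖ := by
  let f : Mat n →ₗ[ℝ] ℝ :=
    { toFun := fun ξ => frob ξ η
      map_add' := fun A B => frob_add_left A B η
      map_smul' := fun c A => frob_smul_left c A η }
  exact exists_le_mul_norm_of_finiteDimensional f

end Frobenius

/-- A superlinear power dominates every linear function up to a constant. -/
theorem exists_mul_sub_mul_rpow_le {p q : ℝ} (hpq : p.HolderConjugate q) {c : ℝ} (hc : 0 < c)
    (C : ℝ) : ∃ M : ℝ, ∀ t : ℝ, 0 ≤ t → C * t - c * t ^ p ≤ M := by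
  have hp : 0 < p := hpq.pos
  -- Young's inequality for `l t` and `C / l`; this `l` turns `(l t)^p / p` into exactly `c t^p`.
  set l : ℝ := (c * p) ^ p⁻¹ with hl
  have hl0 : 0 < l := by positivity
  have hlp : l ^ p = c * p := Real.rpow_inv_rpow (by positivity) hp.ne'
  refine ⟨|C / l| ^ q / q, fun t ht => ?_⟩
  have h := Real.young_inequality (l * t) (C / l) hpq
  rw [abs_of_nonneg (by positivity : 0 ≤ l * t), Real.mul_rpow hl0.le ht, hlp] at h
  have e₁ : l * t * (C / l) = C * t := by field_simp
  have e₂ : c * p * t ^ p / p = c * t ^ p := by field_simp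
  linarith

/-! ### Convex duality and the local distance -/

namespace IsDeviationFunction

variable {n : ℕ} {p q : ℝ} {V : Mat n → ℝ}

/-- Superlinear growth of `V` beats the linear term. Without this bound the real-valued supremum
defining `V*` would be a default value. -/
theorem bddAbove_conjugate (hpq : p.HolderConjugate q) (hV : IsDeviationFunction p q V)
    (η : Mat n) : BddAbove (range fun ξ : Mat n => frob ξ η - V ξ) := by
  obtain ⟨c, hc, hcV⟩ := hV.growth
  obtain ⟨C, hC⟩ := exists_frob_le_mul_norm η
  obtain ⟨M, hM⟩ := exists_mul_sub_mul_rpow_le hpq hc C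
  refine ⟨M, ?_⟩
  rintro _ ⟨ξ, rfl⟩
  have h₁ := hC ξ
  have h₂ := hcV ξ
  have h₃ := hM ‖ξ‖ (norm_nonneg ξ)
  dsimp only
  linarith

theorem conjugate_nonneg (hV : IsDeviationFunction p q V) (η : Mat n) : 0 ≤ conjugate V η := by
  obtain ⟨c, hc, h⟩ := hV.growth_conjugate
  exact le_trans (by positivity) (h η)

theorem conjugate_zero (hV : IsDeviationFunction p q V) : conjugate V 0 = 0 := by
  refine le_antisymm (ciSup_le fun ξ => ?_) (hV.conjugate_nonneg 0)
  rw [frob_zero_right]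
  linarith [hV.nonneg ξ]

theorem convexOn_conjugate (hpq : p.HolderConjugate q) (hV : IsDeviationFunction p q V) :
    ConvexOn ℝ univ (conjugate V) := by
  refine ⟨convex_univ, fun x _ y _ a b ha hb hab => ciSup_le fun ξ => ?_⟩
  have hx : frob ξ x - V ξ ≤ conjugate V x := le_ciSup (hV.bddAbove_conjugate hpq x) ξ
  have hy : frob ξ y - V ξ ≤ conjugate V y := le_ciSup (hV.bddAbove_conjugate hpq y) ξ
  have e : frob ξ (a • x + b • y) - V ξ = a * (frob ξ x - V ξ) + b * (frob ξ y - V ξ) := by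
    rw [frob_add_right, frob_smul_right, frob_smul_right]
    linear_combination (V ξ) * hab
  rw [e, smul_eq_mul, smul_eq_mul]
  gcongr

/-- A finite convex function on a finite-dimensional space is locally Lipschitz. -/
theorem continuous (hV : IsDeviationFunction p q V) : Continuous V :=
  hV.convex.locallyLipschitz.continuous

theorem continuous_conjugate (hpq : p.HolderConjugate q) (hV : IsDeviationFunction p q V) :
    Continuous (conjugate V) :=
  (hV.convexOn_conjugate hpq).locallyLipschitz.continuous

theorem localDeviation_nonneg (hV : IsDeviationFunction p q V) (z z' : Mat n × Mat n) :
    0 ≤ localDeviation V z z' :=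
  add_nonneg (hV.nonneg _) (hV.conjugate_nonneg _)

theorem localDeviation_self (hV : IsDeviationFunction p q V) (z : Mat n × Mat n) :
    localDeviation V z z = 0 := by
  simp [localDeviation, hV.map_zero, hV.conjugate_zero]

theorem bddBelow_localDeviation (hV : IsDeviationFunction p q V) (Dloc : Set (Mat n × Mat n))
    (z : Mat n × Mat n) : BddBelow (localDeviation V z '' Dloc) := by
  refine ⟨0, ?_⟩
  rintro _ ⟨z', -, rfl⟩
  exact hV.localDeviation_nonneg z z'

theorem localDistance_nonpos_of_mem (hV : IsDeviationFunction p q V) {Dloc : Set (Mat n × Mat n)}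
    {z : Mat n × Mat n} (hz : z ∈ Dloc) : localDistance V Dloc z ≤ 0 :=
  (csInf_le (hV.bddBelow_localDeviation Dloc z) ⟨z, hz, rfl⟩).trans_eq (hV.localDeviation_self z)

theorem upperSemicontinuous_localDistance (hpq : p.HolderConjugate q)
    (hV : IsDeviationFunction p q V) (Dloc : Set (Mat n × Mat n)) :
    UpperSemicontinuous (localDistance V Dloc) := by
  have e : localDistance V Dloc = fun z => ⨅ z' : Dloc, localDeviation V z z' := by
    funext z
    rw [localDistance, sInf_image']
  rw [e]
  refine upperSemicontinuous_ciInf (fun z => ?_) fun z' => Continuous.upperSemicontinuous ?_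
  · rw [range_comp' (localDeviation V z), Subtype.range_coe]
    exact hV.bddBelow_localDeviation Dloc z
  · have h₁ := hV.continuous
    have h₂ := hV.continuous_conjugate hpq
    unfold localDeviation
    fun_prop

/-- Small powers of the norm force a small norm. -/
theorem norm_lt_of_mul_rpow_lt {r c ε : ℝ} (hr : 0 < r) (hc : 0 < c) (hε : 0 < ε) {ξ : Mat n}
    (h : c * ‖ξ‖ ^ r < c * ε ^ r) : ‖ξ‖ < ε :=
  (Real.rpow_lt_rpow_iff (norm_nonneg ξ) hε.le hr).1 (lt_of_mul_lt_mul_left h hc.le)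

theorem mem_closure_of_localDistance_nonpos (hpq : p.HolderConjugate q)
    (hV : IsDeviationFunction p q V) {Dloc : Set (Mat n × Mat n)} (hne : Dloc.Nonempty)
    {z : Mat n × Mat n} (hz : localDistance V Dloc z ≤ 0) : z ∈ closure Dloc := by
  obtain ⟨c, hc, hcV⟩ := hV.growth
  obtain ⟨d, hd, hdV⟩ := hV.growth_conjugate
  refine Metric.mem_closure_iff.2 fun ε hε => ?_
  have hp := hpq.pos
  have hq := hpq.symm.pos
  -- Both summands of the deviation are nonnegative, so a deviation below this threshold bounds each
  -- of them, and the growth conditions put both components within `ε`.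
  have hδ : 0 < min (c * ε ^ p) (d * ε ^ q) := by positivity
  obtain ⟨_, ⟨z', hz', rfl⟩, hlt⟩ :=
    exists_lt_of_csInf_lt (hne.image (localDeviation V z)) (hz.trans_lt hδ)
  obtain ⟨hlt₁, hlt₂⟩ := lt_min_iff.1 hlt
  have h₁ := hV.nonneg (z.1 - z'.1)
  have h₂ := hV.conjugate_nonneg (z.2 - z'.2)
  have h₃ := hcV (z.1 - z'.1)
  have h₄ := hdV (z.2 - z'.2)
  unfold localDeviation at hlt₁ hlt₂
  refine ⟨z', hz', ?_⟩
  rw [Prod.dist_eq, max_lt_iff, dist_eq_norm, dist_eq_norm]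
  exact ⟨norm_lt_of_mul_rpow_lt hp hc hε (by linarith),
    norm_lt_of_mul_rpow_lt hq hd hε (by linarith)⟩

end IsDeviationFunction

/-! ### Comparison of the notions of solution -/

section Solutions

variable {n : ℕ} {p q : ℝ} {Ω : TopologicalSpace.Opens (Vec n)} {V : Mat n → ℝ}

theorem aemeasurable_localDistance (hpq : p.HolderConjugate q) (hV : IsDeviationFunction p q V)
    (Dloc : Set (Mat n × Mat n)) (F : LpMat Ω p) (P : LpMat Ω q) :
    AEMeasurable (fun x => localDistance V Dloc (F x, P x))
      (volume.restrict (Ω : Set (Vec n))) :=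
  aemeasurable_comp_of_upperSemicontinuous (hV.upperSemicontinuous_localDistance hpq Dloc)
    (Lp.aestronglyMeasurable F) (Lp.aestronglyMeasurable P)

theorem functionalI_self_eq_zero (hV : IsDeviationFunction p q V) {E D : Set (PhaseSpace Ω p q)}
    {y : PhaseSpace Ω p q} (hy : y ∈ E ∩ D) : functionalI V E D (y, y) = 0 := by
  rw [functionalI, if_pos ⟨hy.1, hy.2⟩]
  simp [hV.localDeviation_self]

theorem isStrongSolution_iff_isGeneralizedSolution (hV : IsDeviationFunction p q V)
    {E D : Set (PhaseSpace Ω p q)} {y : PhaseSpace Ω p q} :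
    IsStrongSolution E D y ↔ IsGeneralizedSolution V E D (y, y) := by
  refine ⟨fun hy => ⟨⟨hy.1, hy.2⟩, fun w _ => ?_⟩, fun h => ⟨h.1.1, h.1.2⟩⟩
  exact (functionalI_self_eq_zero hV hy).trans_le zero_le

theorem isStrongSolution_iff_functionalJ_eq_zero (hpq : p.HolderConjugate q)
    (hV : IsDeviationFunction p q V) {Dloc : Set (Mat n × Mat n)} (hne : Dloc.Nonempty)
    (hcl : IsClosed Dloc) {E : Set (PhaseSpace Ω p q)} {y : PhaseSpace Ω p q} :
    IsStrongSolution E (materialDataSet Ω p q Dloc) y ↔ functionalJ V Dloc E y = 0 := by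
  by_cases hy : y ∈ E
  · have hm := (aemeasurable_localDistance hpq hV Dloc y.1 y.2).ennreal_ofReal
    rw [functionalJ, if_pos hy, lintegral_eq_zero_iff' hm]
    refine Iff.trans (and_iff_right hy) ?_
    change (∀ᵐ x ∂(volume.restrict (Ω : Set (Vec n))), (y.1 x, y.2 x) ∈ Dloc) ↔
      ∀ᵐ x ∂(volume.restrict (Ω : Set (Vec n))),
        ENNReal.ofReal (localDistance V Dloc (y.1 x, y.2 x)) = 0
    refine eventually_congr (Eventually.of_forall fun x => ?_)
    -- Truncation by `ENNReal.ofReal` reduces the claim to `ψ ≤ 0`, so the sign of `ψ` need not be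
    -- discussed.
    rw [ENNReal.ofReal_eq_zero]
    refine ⟨hV.localDistance_nonpos_of_mem, fun h => ?_⟩
    simpa only [hcl.closure_eq] using hV.mem_closure_of_localDistance_nonpos hpq hne h
  · simp [IsStrongSolution, functionalJ, hy]

theorem isStrongSolution_iff_exists_isClassicalSolution {ΓD ΓN : Set (Vec n)} (L : Forcing Ω p q)
    (T : Mat n → Mat n) (F : LpMat Ω p) (P : LpMat Ω q) :
    IsStrongSolution (constraintSet Ω p q ΓD ΓN L) (materialDataSet Ω p q (graphDataSet T)) (F, P) ↔
      ∃ u : Sobolev Ω p, IsClassicalSolution (q := q) T (constraintSet Ω p q ΓD ΓN L) u ∧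
        F = u.grad ∧ IsStressOf T u P := by
  constructor
  · rintro ⟨hE, hD⟩
    obtain ⟨u, hu, -⟩ := hE.1.1
    obtain rfl : F = u.grad := hu
    exact ⟨u, ⟨P, hD, hE⟩, rfl, hD⟩
  · rintro ⟨u, ⟨S, hS, hE⟩, rfl, hP⟩
    -- Both fields equal `T(Du)` a.e., so they are the same `L^q` class; measurability of `T` is not
    -- needed.
    obtain rfl : S = P := Lp.ext (by filter_upwards [hS, hP] with x h₁ h₂ using h₁.trans h₂.symm)
    exact ⟨hE, hP⟩

end Solutions

end DataDriven

theorem mainTheorem10 {n : ℕ} {p q : ℝ} (hpq : p.HolderConjugate q)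
    (Ω : TopologicalSpace.Opens (Vec n)) (ΓD ΓN : Set (Vec n))
    (hΩ : IsReferenceBody (Ω : Set (Vec n)) ΓD ΓN) (L : Forcing Ω p q)
    (V : Mat n → ℝ) (hV : IsDeviationFunction p q V)
    (Dloc : Set (Mat n × Mat n)) (hne : Dloc.Nonempty)
    (E D : Set (PhaseSpace Ω p q)) (hE : E = constraintSet Ω p q ΓD ΓN L)
    (hD : D = materialDataSet Ω p q Dloc) (F : LpMat Ω p) (P : LpMat Ω q) :
    (IsStrongSolution E D (F, P) ↔ IsGeneralizedSolution V E D ((F, P), (F, P))) ∧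
    (IsClosed Dloc → (IsStrongSolution E D (F, P) ↔ functionalJ V Dloc E (F, P) = 0)) ∧
    (∀ T : Mat n → Mat n, D = materialDataSet Ω p q (graphDataSet T) →
      (IsStrongSolution E D (F, P) ↔
        ∃ u : Sobolev Ω p, IsClassicalSolution (q := q) T E u ∧ F = u.grad ∧ IsStressOf T u P)) := by

  subst hE hD
  exact ⟨isStrongSolution_iff_isGeneralizedSolution hV,
    fun hcl => isStrongSolution_iff_functionalJ_eq_zero hpq hV hne hcl,
    -- Only the sets of fields are identified here; `Dloc` itself may differ from the graph of `T`.
    fun T hT => hT ▸ isStrongSolution_iff_exists_isClassicalSolution L T F P⟩
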